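/- Let $\mathcal{S}_n$ be the set of permutations of $\{1,\dots,n\}$, written as words $\pi(1)\pi(2)\cdots\pi(n)$, and let $\mathcal{S}=\bigcup_{n\ge 0}\mathcal{S}_n$. For $\tau\in\mathcal{S}_k$, a word $\beta=b_1\cdots b_k$ of integers is an occurrence of $\tau$ if there is an integer $c$ with $\tau(i)-b_i=c$ for all $i$. A permutation $\pi$ avoids the (Hertzsprung) pattern $\tau$ if no factor (contiguous subword) of $\pi$ is an occurrence of $\tau$. Write $\mathcal{S}_n(\tau_1,\dots,\tau_r)$ for the set of permutations in $\mathcal{S}_n$ that avoid all of $\tau_1,\dots,\tau_r$. Let $R=\{132\to 123,\ 321\to 123,\ 2341\to 4123\}$, and let $\to$ be the relation on $\mathcal{S}$ for which $\pi\to\pi'$ if and only if there are a rule $\alpha\to\beta$ in $R$ and words $\sigma,\hat\alpha,\hat\beta,\rho$ such that $\pi=\sigma\hat\alpha\rho$, $\pi'=\sigma\hat\beta\rho$, $\hat\alpha$ is an occurrence of $\alpha$, and $\hat\beta$ is an occurrence of $\beta$. Let $\equiv$ be the equivalence relation $123\equiv132\equiv321$, that is, the equivalence relation on $\mathcal{S}$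 generated by replacing, in a permutation, a factor that is an occurrence of one of $123$, $132$, $321$ by an occurrence of another of these three patterns so that the result is again a permutation. Then: 1. $\to$ is terminating: there is no infinite chain $\pi_0\to\pi_1\to\pi_2\to\cdots$. 2. $\to$ is confluent: writing $\stackrel{*}{\to}$ for the reflexive transitive closure of $\to$, if $\pi\stackrel{*}{\to}\rho_1$ and $\pi\stackrel{*}{\to}\rho_2$, then there is $\sigma\in\mathcal{S}$ with $\rho_1\stackrel{*}{\to}\sigma$ and $\rho_2\stackrel{*}{\to}\sigma$. 3. The equivalence closure (reflexive symmetric transitive closure) of $\to$ is $\equiv$. 4. For every $n\ge 0$, the number of equivalence classes of $\mathcal{S}_n$ under $\equiv$ equals $|\mathcal{S}_n(132,321,2341)|$. 5. As formal power series, \[ \sum_{n\ge 0}|\mathcal{S}_n(132,321,2341)|\,x^n=\sum_{m\ge 0} m!\,\bigl(x(1-2x^2)\bigr)^m . \] -/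

import Mathlib

open scoped PowerSeries.WithPiTopology

namespace Hertzsprung

/-- The set `𝒮 = ⋃ₙ 𝒮ₙ` of all permutations, of all lengths `n ≥ 0`. -/
abbrev Perms : Type := Σ n : ℕ, Equiv.Perm (Fin n)

/-- The one-line notation `π(1) π(2) ⋯ π(n)` of a permutation, with letters `1, …, n`
(permutations of `Fin n` are zero-based, hence the `+ 1`). -/
def word {n : ℕ} (π : Equiv.Perm (Fin n)) : List ℤ :=
  List.ofFn fun i : Fin n => ((π i : ℕ) : ℤ) + 1

/-- `IsOccurrence τ β` is `β ≃ τ`: the word `β = b₁ ⋯ b_k` has the same length as `τ`, and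
`τ(i) - b_i = c` for all `i`, for some integer `c`. -/
def IsOccurrence {k : ℕ} (τ : Equiv.Perm (Fin k)) (β : List ℤ) : Prop :=
  ∃ c : ℤ, word τ = β.map (fun b => b + c)

/-- `τ` is a Hertzsprung factor of `π`: some factor (contiguous subword) of `π` is an
occurrence of `τ`. -/
def IsHertzsprungFactor {k n : ℕ} (τ : Equiv.Perm (Fin k)) (π : Equiv.Perm (Fin n)) : Prop :=
  ∃ β : List ℤ, β <:+: word π ∧ IsOccurrence τ β

/-- `𝒮ₙ(T)`: the permutations of length `n` that avoid every Hertzsprung pattern in `T`. -/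
def avoiders (T : Set Perms) (n : ℕ) : Set (Equiv.Perm (Fin n)) :=
  {π | ∀ τ ∈ T, ¬ IsHertzsprungFactor τ.2 π}

/-- A pattern-rewriting system: a subset of `⋃ₙ 𝒮ₙ × 𝒮ₙ`. -/
abbrev PatternRewritingSystem : Type :=
  Set (Σ n : ℕ, Equiv.Perm (Fin n) × Equiv.Perm (Fin n))

/-- The rewrite relation `π →_R π'` on `𝒮` induced by `R`: for some rule `α → β` in `R`,
`π = σ α' τ` and `π' = σ β' τ` with `α' ≃ α` and `β' ≃ β`. -/
def Rewrites (R : PatternRewritingSystem) (π π' : Perms) : Prop :=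
  ∃ r ∈ R, ∃ σ α' β' τ : List ℤ,
    IsOccurrence r.2.1 α' ∧ IsOccurrence r.2.2 β' ∧
      word π.2 = σ ++ α' ++ τ ∧ word π'.2 = σ ++ β' ++ τ

/-- There is no infinite chain `x₀ → x₁ → x₂ → ⋯`. -/
def Terminating {X : Type*} (r : X → X → Prop) : Prop :=
  ¬ ∃ x : ℕ → X, ∀ i : ℕ, r (x i) (x (i + 1))

/-- If `x →* y₁` and `x →* y₂`, then `y₁ →* z` and `y₂ →* z` for some `z`. -/
def Confluent {X : Type*} (r : X → X → Prop) : Prop :=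
  ∀ x y₁ y₂ : X, Relation.ReflTransGen r x y₁ → Relation.ReflTransGen r x y₂ →
    ∃ z : X, Relation.ReflTransGen r y₁ z ∧ Relation.ReflTransGen r y₂ z

/-- All rules `α → β` with `α, β ∈ P`, where `P` is a set of patterns of length `k`. -/
def allReplacements {k : ℕ} (P : Set (Equiv.Perm (Fin k))) : PatternRewritingSystem :=
  {r | ∃ α ∈ P, ∃ β ∈ P, r = ⟨k, (α, β)⟩}

/-- The pattern-replacement equivalence `α₁ ≡ α₂ ≡ ⋯ ≡ α_m` on `𝒮`, for `P = {α₁, …, α_m}`: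
the equivalence relation generated by replacing an occurrence of one pattern in `P` by an
occurrence of another one. -/
def replacementSetoid {k : ℕ} (P : Set (Equiv.Perm (Fin k))) : Setoid Perms :=
  Relation.EqvGen.setoid (Rewrites (allReplacements P))

/-- The set `𝒮ₙ / ≡` of equivalence classes of permutations of length `n`. -/
def Classes (s : Setoid Perms) (n : ℕ) : Type :=
  Quotient (s.comap (fun π : Equiv.Perm (Fin n) => (⟨n, π⟩ : Perms)))

def p123 : Equiv.Perm (Fin 3) := ⟨![0, 1, 2], ![0, 1, 2], by decide, by decide⟩
def p132 : Equiv.Perm (Fin 3) := ⟨![0, 2, 1], ![0, 2, 1], by decide, by decide⟩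
def p321 : Equiv.Perm (Fin 3) := ⟨![2, 1, 0], ![2, 1, 0], by decide, by decide⟩
def p2341 : Equiv.Perm (Fin 4) := ⟨![1, 2, 3, 0], ![3, 0, 1, 2], by decide, by decide⟩
def p4123 : Equiv.Perm (Fin 4) := ⟨![3, 0, 1, 2], ![1, 2, 3, 0], by decide, by decide⟩

theorem word_p123 : word p123 = [1, 2, 3] := by decide
theorem word_p132 : word p132 = [1, 3, 2] := by decide
theorem word_p321 : word p321 = [3, 2, 1] := by decide
theorem word_p2341 : word p2341 = [2, 3, 4, 1] := by decide
theorem word_p4123 : word p4123 = [4, 1, 2, 3] := by decide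

/-- The pattern-rewriting system `{132 → 123, 321 → 123, 2341 → 4123}`. -/
def system : PatternRewritingSystem :=
  {⟨3, (p132, p123)⟩, ⟨3, (p321, p123)⟩, ⟨4, (p2341, p4123)⟩}

end Hertzsprung

/-! Rewriting is studied on integer words without repeated letters. It terminates because every rule
increases the bounded sum of the letters weighted by squared positions (`Step.potential_lt`). By
Newman's lemma, confluence then reduces to overlapping left-hand sides. Distinctness of letters
leaves only 4321, 54321 and 456321, and each joins (`Step.join`). The rule 2341 → 4123 joins the
4321 overlap. It preserves `≡`, since 2341 ≡ 4321 ≡ 4123. So each class contains exactly one normal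
form, and normal forms are the avoiders (`card_classes`).

For the count, let a(n, p) be the number of permutations of length n that are normal after their
first p letters. A word counted by a(n+2, p+1) but not by a(n+2, p) has a left-hand side starting
exactly at position p. If it is 132, contract it to one letter. If it is 321 or 2341, contract the
321 or the 234: a 321 followed by the next smaller value is impossible, as another 321 would start
one place later, while a contracted 234 is always followed by that value. The two cases are thus
complementary and together give one copy of a(n, p+1), so a(n+2, p+1) = a(n+2, p) + 2a(n, p+1) for p
< n (`ncard_normalFrom_succ`). With F_p = ∑ a(p+s, p) xˢ this reads F_p = p! + x(1 − 2x²) F_{p+1},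
and iterating from F_0 gives the series. -/

namespace Hertzsprung

/-! ### Rewriting of integer words and its potential -/

/-- The rewriting of `system`, on arbitrary words of integers. -/
inductive Step : List ℤ → List ℤ → Prop
  | r132 {a b c : ℤ} (τ : List ℤ) (hb : b = a + 2) (hc : c = a + 1) :
      Step (a :: b :: c :: τ) (a :: c :: b :: τ)
  | r321 {a b c : ℤ} (τ : List ℤ) (hb : b = a - 1) (hc : c = a - 2) :
      Step (a :: b :: c :: τ) (c :: b :: a :: τ)
  | r2341 {a b c d : ℤ} (τ : List ℤ) (hb : b = a + 1) (hc : c = a + 2) (hd : d = a - 1) :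
      Step (a :: b :: c :: d :: τ) (c :: d :: a :: b :: τ)
  | cons (x : ℤ) {l l' : List ℤ} (h : Step l l') : Step (x :: l) (x :: l')

open Relation

theorem Step.append_left (σ : List ℤ) {l l' : List ℤ} (h : Step l l') :
    Step (σ ++ l) (σ ++ l') := by
  induction σ with
  | nil => exact h
  | cons x σ ih => exact ih.cons x

theorem Step.perm {l l' : List ℤ} (h : Step l l') : l'.Perm l := by
  induction h with
  | r132 τ => exact (List.Perm.swap _ _ _).cons _
  | r321 τ =>
    rw [List.perm_iff_count]; intro x; simp only [List.count_cons]; omega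
  | r2341 τ =>
    rw [List.perm_iff_count]; intro x; simp only [List.count_cons]; omega
  | cons x _ ih => exact ih.cons x

theorem reflTransGen_cons (x : ℤ) {l l' : List ℤ} (h : ReflTransGen Step l l') :
    ReflTransGen Step (x :: l) (x :: l') :=
  h.lift (x :: ·) (fun _ _ h => Step.cons x h)

/-- The potential `∑ᵢ (k + i)² lᵢ`. -/
def potential : ℤ → List ℤ → ℤ
  | _, [] => 0
  | k, x :: l => k ^ 2 * x + potential (k + 1) l

/-- Linear weights would not do: 2341 → 4123 preserves ∑ i·lᵢ. With squares, the rules for 132, 321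
and 2341 gain 2k + 3, 8k + 8 and 8 at position k. -/
theorem Step.potential_lt {l l' : List ℤ} (h : Step l l') :
    ∀ k : ℤ, 0 ≤ k → potential k l < potential k l' := by
  induction h with
  | r132 τ hb hc => intro k hk; subst hb hc; simp only [potential]; nlinarith
  | r321 τ hb hc => intro k hk; subst hb hc; simp only [potential]; nlinarith
  | r2341 τ hb hc hd => intro k hk; subst hb hc hd; simp only [potential]; nlinarith
  | cons x _ ih =>
    intro k hk
    have := ih (k + 1) (by omega)
    simp only [potential]; omega

theorem potential_le (n : ℤ) (l : List ℤ) (hl : ∀ x ∈ l, x ≤ n) :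
    ∀ k : ℤ, potential k l ≤ potential k (List.replicate l.length n) := by
  induction l with
  | nil => intro k; simp [potential]
  | cons x l ih =>
    intro k
    have h1 := ih (fun y hy => hl y (by simp [hy])) (k + 1)
    have h2 := hl x (by simp)
    simp only [potential, List.length_cons, List.replicate_succ]
    nlinarith [mul_le_mul_of_nonneg_left h2 (sq_nonneg k)]

/-! ### Newman's lemma and critical pairs -/

theorem newman {X : Type*} {r : X → X → Prop} (wf : WellFounded (flip r))
    (hr : ∀ x y₁ y₂, r x y₁ → r x y₂ → Join (ReflTransGen r) y₁ y₂) :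
    Confluent r := by
  intro x
  induction x using wf.induction with
  | _ x ih =>
    intro y₁ y₂ h₁ h₂
    rcases ReflTransGen.cases_head h₁ with rfl | ⟨z₁, hz₁, h₁'⟩
    · exact ⟨y₂, h₂, .refl⟩
    rcases ReflTransGen.cases_head h₂ with rfl | ⟨z₂, hz₂, h₂'⟩
    · exact ⟨y₁, .refl, h₁⟩
    obtain ⟨w, hw₁, hw₂⟩ := hr x z₁ z₂ hz₁ hz₂
    obtain ⟨v, hv₁, hv₂⟩ := ih z₁ hz₁ y₁ w h₁' hw₁
    obtain ⟨t, ht₁, ht₂⟩ := ih z₂ hz₂ v y₂ (hw₂.trans hv₂) h₂'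
    exact ⟨t, hv₁.trans ht₁, ht₂⟩

/-- Steps on disjoint factors commute. A different left-hand side meeting this 132 would force a
repeated letter, so there is no critical pair. -/
theorem join_r132 {a b c : ℤ} {τ l₂ : List ℤ} (hb : b = a + 2) (hc : c = a + 1)
    (hl : (a :: b :: c :: τ).Nodup) (h₂ : Step (a :: b :: c :: τ) l₂) :
    Join (ReflTransGen Step) (a :: c :: b :: τ) l₂ := by
  rcases h₂ with _ | _ | _ | ⟨_, _ | _ | _ | ⟨_, _ | _ | _ | ⟨_, h⟩⟩⟩
  on_goal 10 => exact ⟨_, .single (((h.cons _).cons _).cons _), .single (.r132 _ hb hc)⟩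
  on_goal 1 => exact ⟨_, .refl, .refl⟩
  all_goals simp only [List.nodup_cons, List.mem_cons, not_or] at hl
  all_goals omega

theorem join_r321 {a b c : ℤ} {τ l₂ : List ℤ} (hb : b = a - 1) (hc : c = a - 2)
    (hl : (a :: b :: c :: τ).Nodup) (h₂ : Step (a :: b :: c :: τ) l₂) :
    Join (ReflTransGen Step) (c :: b :: a :: τ) l₂ := by
  rcases h₂ with _ | _ | _ | ⟨_, _ | _ | _ | ⟨_, _ | _ | _ | ⟨_, h⟩⟩⟩
  on_goal 10 => exact ⟨_, .single (((h.cons _).cons _).cons _), .single (.r321 _ hb hc)⟩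
  -- The overlap 54321: 34521 → 52341 → 54123.
  on_goal 8 =>
    exact ⟨_, .head (.r2341 _ (by omega) (by omega) (by omega))
      (.single (.cons _ (.r2341 _ (by omega) (by omega) (by omega)))), .refl⟩
  -- The overlap 4321, whose reducts 2341 and 4123 are the two sides of the third rule.
  on_goal 5 => exact ⟨_, .single (.r2341 _ (by omega) (by omega) (by omega)), .refl⟩
  on_goal 2 => exact ⟨_, .refl, .refl⟩
  all_goals simp only [List.nodup_cons, List.mem_cons, not_or] at hl
  all_goals omega

theorem join_r2341 {a b c d : ℤ} {τ l₂ : List ℤ} (hb : b = a + 1) (hc : c = a + 2)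
    (hd : d = a - 1) (hl : (a :: b :: c :: d :: τ).Nodup)
    (h₂ : Step (a :: b :: c :: d :: τ) l₂) :
    Join (ReflTransGen Step) (c :: d :: a :: b :: τ) l₂ := by
  rcases h₂ with _ | _ | _ | ⟨_, _ | _ | _ | ⟨_, _ | _ | _ | ⟨_, _ | _ | _ | ⟨_, h⟩⟩⟩⟩
  on_goal 13 =>
    exact ⟨_, .single ((((h.cons _).cons _).cons _).cons _), .single (.r2341 _ hb hc hd)⟩
  -- The overlap 456321: 634521 → 652341 → 654123 → 456123.
  on_goal 11 =>
    exact ⟨_, .head (.cons _ (.r2341 _ (by omega) (by omega) (by omega)))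
      (.head (.cons _ (.cons _ (.r2341 _ (by omega) (by omega) (by omega))))
      (.single (.r321 _ (by omega) (by omega)))), .refl⟩
  on_goal 3 => exact ⟨_, .refl, .refl⟩
  all_goals simp only [List.nodup_cons, List.mem_cons, not_or] at hl
  all_goals omega

theorem Step.join {l l₁ l₂ : List ℤ} (hl : l.Nodup) (h₁ : Step l l₁) (h₂ : Step l l₂) :
    Join (ReflTransGen Step) l₁ l₂ := by
  induction h₁ generalizing l₂ with
  | r132 τ hb hc => exact join_r132 hb hc hl h₂
  | r321 τ hb hc => exact join_r321 hb hc hl h₂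
  | r2341 τ hb hc hd => exact join_r2341 hb hc hd hl h₂
  | cons x h ih =>
    cases h₂ with
    | r132 τ hb hc => exact
      let ⟨z, p, q⟩ := join_r132 hb hc hl (h.cons x); ⟨z, q, p⟩
    | r321 τ hb hc => exact
      let ⟨z, p, q⟩ := join_r321 hb hc hl (h.cons x); ⟨z, q, p⟩
    | r2341 τ hb hc hd => exact
      let ⟨z, p, q⟩ := join_r2341 hb hc hd hl (h.cons x); ⟨z, q, p⟩
    | cons _ h' =>
      obtain ⟨z, h₁, h₂⟩ := ih hl.of_cons h'
      exact ⟨x :: z, reflTransGen_cons x h₁, reflTransGen_cons x h₂⟩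
-- Permutations as words
/-- `l` is the one-line notation of a permutation of length `n`. -/
def IsWord (n : ℕ) (l : List ℤ) : Prop :=
  l.Nodup ∧ l.length = n ∧ ∀ x ∈ l, 1 ≤ x ∧ x ≤ n

theorem IsWord.of_perm {n : ℕ} {l l' : List ℤ} (h : IsWord n l) (p : l'.Perm l) : IsWord n l' :=
  ⟨p.nodup_iff.2 h.1, p.length_eq.trans h.2.1, fun x hx => h.2.2 x (p.mem_iff.1 hx)⟩

theorem length_word {n : ℕ} (π : Equiv.Perm (Fin n)) : (word π).length = n := by
  simp [word]

theorem isWord_word {n : ℕ} (π : Equiv.Perm (Fin n)) : IsWord n (word π) := by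
  refine ⟨?_, length_word π, ?_⟩
  · refine List.nodup_ofFn.2 fun i j h => ?_
    have h' : (π i : ℕ) = π j := by simpa using h
    exact π.injective (Fin.ext h')
  · intro x hx
    obtain ⟨i, rfl⟩ := List.mem_ofFn.1 hx
    have := (π i).2
    omega

theorem word_injective {n : ℕ} : Function.Injective (word : Equiv.Perm (Fin n) → List ℤ) := by
  intro π σ h
  ext i
  have := congrFun (List.ofFn_injective h) i
  simpa using this

theorem IsWord.exists_word {n : ℕ} {l : List ℤ} (h : IsWord n l) :
    ∃ π : Equiv.Perm (Fin n), word π = l := by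
  obtain ⟨hnd, rfl, hr⟩ := h
  have hr' : ∀ i : Fin l.length, 1 ≤ l[i] ∧ l[i] ≤ l.length := fun i => hr _ (List.getElem_mem _)
  let f : Fin l.length → Fin l.length := fun i => ⟨(l[i] - 1).toNat, by have := hr' i; omega⟩
  have hf : Function.Injective f := by
    intro i j hij
    have h1 := hr' i
    have h2 := hr' j
    have h3 : (l[i] - 1).toNat = (l[j] - 1).toNat := congrArg Fin.val hij
    have h4 : l[i] = l[j] := by omega
    exact Fin.ext (hnd.getElem_inj_iff.1 h4)
  refine ⟨Equiv.ofBijective f (Finite.injective_iff_bijective.1 hf), ?_⟩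
  refine List.ext_getElem (by simp [word]) fun i h1 h2 => ?_
  have := hr' ⟨i, h2⟩
  simp only [word, List.getElem_ofFn, Equiv.ofBijective_apply, f]
  simp only [Fin.getElem_fin] at this ⊢
  omega

theorem perm_word_word {n : ℕ} (π σ : Equiv.Perm (Fin n)) : (word π).Perm (word σ) := by
  have key (ρ : Equiv.Perm (Fin n)) :
      (word ρ).Perm (List.ofFn fun i : Fin n => ((i : ℕ) : ℤ) + 1) :=
    Equiv.Perm.ofFn_comp_perm ρ fun i : Fin n => ((i : ℕ) : ℤ) + 1
  exact (key π).trans (key σ).symm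

theorem perms_ext {π σ : Perms} (h : word π.2 = word σ.2) : π = σ := by
  obtain ⟨n, π⟩ := π
  obtain ⟨m, σ⟩ := σ
  obtain rfl : n = m := by simpa [length_word] using congrArg List.length h
  exact congrArg _ (word_injective h)

theorem isOccurrence_iff {k : ℕ} (τ : Equiv.Perm (Fin k)) (β : List ℤ) :
    IsOccurrence τ β ↔ ∃ c : ℤ, β = (word τ).map (· + c) := by
  constructor
  · rintro ⟨c, hc⟩
    exact ⟨-c, by simp [hc]⟩
  · rintro ⟨c, hc⟩
    exact ⟨-c, by simp [hc]⟩

theorem isOccurrence_p123 {β : List ℤ} :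
    IsOccurrence p123 β ↔ ∃ c : ℤ, β = [1 + c, 2 + c, 3 + c] := by
  simp [isOccurrence_iff, word_p123]

theorem isOccurrence_p132 {β : List ℤ} :
    IsOccurrence p132 β ↔ ∃ c : ℤ, β = [1 + c, 3 + c, 2 + c] := by
  simp [isOccurrence_iff, word_p132]

theorem isOccurrence_p321 {β : List ℤ} :
    IsOccurrence p321 β ↔ ∃ c : ℤ, β = [3 + c, 2 + c, 1 + c] := by
  simp [isOccurrence_iff, word_p321]

theorem isOccurrence_p2341 {β : List ℤ} :
    IsOccurrence p2341 β ↔ ∃ c : ℤ, β = [2 + c, 3 + c, 4 + c, 1 + c] := by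
  simp [isOccurrence_iff, word_p2341]

theorem isOccurrence_p4123 {β : List ℤ} :
    IsOccurrence p4123 β ↔ ∃ c : ℤ, β = [4 + c, 1 + c, 2 + c, 3 + c] := by
  simp [isOccurrence_iff, word_p4123]

/-- Factors of the same length completed to words of permutations by the same prefix and suffix
have the same sum. -/
theorem sum_eq_of_word {π π' : Perms} {σ α β τ : List ℤ} (hl : α.length = β.length)
    (h : word π.2 = σ ++ α ++ τ) (h' : word π'.2 = σ ++ β ++ τ) : α.sum = β.sum := by
  obtain ⟨n, π⟩ := π
  obtain ⟨m, π'⟩ := π'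
  have hn := congrArg List.length h
  have hm := congrArg List.length h'
  simp only [length_word, List.length_append] at hn hm
  obtain rfl : n = m := by omega
  have := (perm_word_word π π').sum_eq
  simp only at h h'
  rw [h, h'] at this
  simpa using this

theorem step_of_rewrites {π π' : Perms} (h : Rewrites system π π') :
    Step (word π.2) (word π'.2) := by
  obtain ⟨r, hr, σ, α, β, τ, hα, hβ, h, h'⟩ := h
  rcases hr with rfl | rfl | rfl
  · obtain ⟨c, rfl⟩ := isOccurrence_p132.1 hα
    obtain ⟨d, rfl⟩ := isOccurrence_p123.1 hβ
    -- Each occurrence carries its own shift; equal letter sums force the two shifts to agree.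
    have := sum_eq_of_word (by simp) h h'
    obtain rfl : c = d := by simp at this; omega
    rw [h, h', List.append_assoc, List.append_assoc]
    exact .append_left σ (.r132 _ (by ring) (by ring))
  · obtain ⟨c, rfl⟩ := isOccurrence_p321.1 hα
    obtain ⟨d, rfl⟩ := isOccurrence_p123.1 hβ
    have := sum_eq_of_word (by simp) h h'
    obtain rfl : c = d := by simp at this; omega
    rw [h, h', List.append_assoc, List.append_assoc]
    exact .append_left σ (.r321 _ (by ring) (by ring))
  · obtain ⟨c, rfl⟩ := isOccurrence_p2341.1 hα
    obtain ⟨d, rfl⟩ := isOccurrence_p4123.1 hβ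
    have := sum_eq_of_word (by simp) h h'
    obtain rfl : c = d := by simp at this; omega
    rw [h, h', List.append_assoc, List.append_assoc]
    exact .append_left σ (.r2341 _ (by ring) (by ring) (by ring))

theorem Step.exists_factor {l l' : List ℤ} (h : Step l l') :
    ∃ r ∈ system, ∃ σ α β τ : List ℤ, IsOccurrence r.2.1 α ∧ IsOccurrence r.2.2 β ∧
      l = σ ++ α ++ τ ∧ l' = σ ++ β ++ τ := by
  induction h with
  | @r132 a b c τ hb hc =>
    refine ⟨⟨3, (p132, p123)⟩, by simp [system], [], [a, b, c], [a, c, b], τ,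
      isOccurrence_p132.2 ⟨a - 1, ?_⟩, isOccurrence_p123.2 ⟨a - 1, ?_⟩, rfl, rfl⟩ <;>
    simp <;> omega
  | @r321 a b c τ hb hc =>
    refine ⟨⟨3, (p321, p123)⟩, by simp [system], [], [a, b, c], [c, b, a], τ,
      isOccurrence_p321.2 ⟨a - 3, ?_⟩, isOccurrence_p123.2 ⟨a - 3, ?_⟩, rfl, rfl⟩ <;>
    simp <;> omega
  | @r2341 a b c d τ hb hc hd =>
    refine ⟨⟨4, (p2341, p4123)⟩, by simp [system], [], [a, b, c, d], [c, d, a, b], τ,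
      isOccurrence_p2341.2 ⟨a - 2, ?_⟩, isOccurrence_p4123.2 ⟨a - 2, ?_⟩, rfl, rfl⟩ <;>
    simp <;> omega
  | cons x _ ih =>
    obtain ⟨r, hr, σ, α, β, τ, hα, hβ, rfl, rfl⟩ := ih
    exact ⟨r, hr, x :: σ, α, β, τ, hα, hβ, rfl, rfl⟩

theorem rewrites_iff_step {π π' : Perms} :
    Rewrites system π π' ↔ Step (word π.2) (word π'.2) :=
  ⟨step_of_rewrites, fun h => by
    obtain ⟨r, hr, σ, α, β, τ, h⟩ := h.exists_factor
    exact ⟨r, hr, σ, α, β, τ, h⟩⟩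

theorem exists_perms_of_perm {π : Perms} {l : List ℤ} (h : l.Perm (word π.2)) :
    ∃ π' : Perms, π'.1 = π.1 ∧ word π'.2 = l := by
  obtain ⟨π', h'⟩ := ((isWord_word π.2).of_perm h).exists_word
  exact ⟨⟨_, π'⟩, rfl, h'⟩

theorem rewrites_fst_eq {R : PatternRewritingSystem} {π π' : Perms} (h : Rewrites R π π') :
    π.1 = π'.1 := by
  obtain ⟨r, hr, σ, α, β, τ, ⟨c, hα⟩, ⟨d, hβ⟩, h, h'⟩ := h
  have h1 := congrArg List.length h
  have h2 := congrArg List.length h'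
  have h3 := congrArg List.length hα
  have h4 := congrArg List.length hβ
  simp only [length_word, List.length_append, List.length_map] at h1 h2 h3 h4
  omega

theorem fst_eq_of_eqvGen {R : PatternRewritingSystem} {π π' : Perms}
    (h : EqvGen (Rewrites R) π π') : π.1 = π'.1 := by
  induction h with
  | rel _ _ h => exact rewrites_fst_eq h
  | refl => rfl
  | symm _ _ _ ih => exact ih.symm
  | trans _ _ _ _ _ ih₁ ih₂ => exact ih₁.trans ih₂

/-! ### Termination and confluence on permutations -/

theorem wellFounded_rewrites : WellFounded (flip (Rewrites system)) := by
  -- The distance to the bound given by the constant word n⋯n: nonnegative, and decreasing along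
  -- rewrites.
  let M : Perms → ℤ := fun π =>
    potential 0 (List.replicate π.1 (π.1 : ℤ)) - potential 0 (word π.2)
  have hM (π : Perms) : 0 ≤ M π := by
    have := potential_le π.1 (word π.2) (fun x hx => ((isWord_word π.2).2.2 x hx).2) 0
    rw [length_word] at this
    exact sub_nonneg.2 this
  refine Subrelation.wf (r := InvImage (· < ·) fun π => (M π).toNat) ?_
    (InvImage.wf _ wellFounded_lt)
  intro π' π h
  have h1 : π.1 = π'.1 := rewrites_fst_eq h
  have h2 := (step_of_rewrites h).potential_lt 0 le_rfl
  have h3 : M π' < M π := by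
    simp only [M, h1]
    omega
  have := hM π'
  change (M π').toNat < (M π).toNat
  omega

theorem terminating_of_wellFounded {X : Type*} {r : X → X → Prop} (wf : WellFounded (flip r)) :
    Terminating r := by
  rintro ⟨x, hx⟩
  exact (wellFounded_iff_isEmpty_descending_chain.1 wf).false ⟨x, hx⟩

theorem reflTransGen_of_step {π : Perms} {l : List ℤ}
    (h : ReflTransGen Step (word π.2) l) :
    ∃ π' : Perms, word π'.2 = l ∧ ReflTransGen (Rewrites system) π π' := by
  induction h with
  | refl => exact ⟨π, rfl, .refl⟩
  | tail _ h ih =>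
    obtain ⟨ρ, rfl, hρ⟩ := ih
    obtain ⟨π', -, rfl⟩ := exists_perms_of_perm h.perm
    exact ⟨π', rfl, hρ.tail (rewrites_iff_step.2 h)⟩

theorem confluent_rewrites : Confluent (Rewrites system) := by
  refine newman wellFounded_rewrites fun x y₁ y₂ h₁ h₂ => ?_
  obtain ⟨l, hl₁, hl₂⟩ := (step_of_rewrites h₁).join (isWord_word x.2).1 (step_of_rewrites h₂)
  obtain ⟨z, rfl, hz⟩ := reflTransGen_of_step hl₁
  obtain ⟨z', hz', hz₂⟩ := reflTransGen_of_step hl₂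
  rw [perms_ext hz'] at hz₂
  exact ⟨z, hz, hz₂⟩

/-! ### The generated equivalence -/

/-- The three patterns of length three that are identified. -/
abbrev patterns : Set (Equiv.Perm (Fin 3)) := {p123, p132, p321}

theorem rewrites_allReplacements {α β : Equiv.Perm (Fin 3)} (hα : α ∈ patterns)
    (hβ : β ∈ patterns) (c : ℤ) (σ τ : List ℤ) {π π' : Perms}
    (h : word π.2 = σ ++ (word α).map (· + c) ++ τ)
    (h' : word π'.2 = σ ++ (word β).map (· + c) ++ τ) :
    Rewrites (allReplacements patterns) π π' :=
  ⟨⟨3, (α, β)⟩, ⟨α, hα, β, hβ, rfl⟩, σ, _, _, τ, (isOccurrence_iff _ _).2 ⟨c, rfl⟩,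
    (isOccurrence_iff _ _).2 ⟨c, rfl⟩, h, h'⟩

theorem replacement_of_step {π π' : Perms} (σ : List ℤ) {l l' : List ℤ}
    (hs : Step l l') (h : word π.2 = σ ++ l) (h' : word π'.2 = σ ++ l') :
    EqvGen (Rewrites (allReplacements patterns)) π π' := by
  induction hs generalizing σ with
  | @r132 a b c τ hb hc =>
    refine .rel _ _ (rewrites_allReplacements (α := p132) (β := p123) (by simp) (by simp)
      (a - 1) σ τ ?_ ?_)
    · simp [h, word_p132, hb, hc]; omega
    · simp [h', word_p123, hb, hc]; omega
  | @r321 a b c τ hb hc =>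
    refine .rel _ _ (rewrites_allReplacements (α := p321) (β := p123) (by simp) (by simp)
      (a - 3) σ τ ?_ ?_)
    · simp [h, word_p321, hb, hc]; omega
    · simp [h', word_p123, hb, hc]; omega
  | @r2341 a b c d τ hb hc hd =>
    -- The third rule factors as 2341 ≡ 4321 ≡ 4123: reverse 234, then reverse 321.
    obtain ⟨ρ, -, hρ⟩ : ∃ ρ : Perms, ρ.1 = π.1 ∧ word ρ.2 = σ ++ c :: b :: a :: d :: τ := by
      refine exists_perms_of_perm ?_
      rw [h]
      refine List.Perm.append_left σ ?_
      rw [List.perm_iff_count]; intro x; simp only [List.count_cons]; omega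
    refine .trans _ ρ _ (.rel _ _ (rewrites_allReplacements (α := p123) (β := p321) (by simp)
      (by simp) (a - 1) σ (d :: τ) ?_ ?_)) (.rel _ _ (rewrites_allReplacements (α := p321)
      (β := p123) (by simp) (by simp) (a - 2) (σ ++ [c]) τ ?_ ?_))
    · simp [h, word_p123, hb, hc]; omega
    · simp [hρ, word_p321, hb, hc]; omega
    · simp [hρ, word_p321, hb, hc, hd]; omega
    · simp [h', word_p123, hb, hc, hd]; omega
  | cons x _ ih => exact ih (σ ++ [x]) (by simp [h]) (by simp [h'])

/-- Any two of the three patterns are linked through 123, which each reaches in at most one step. -/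
theorem eqvGen_p123 {π : Perms} {α : Equiv.Perm (Fin 3)} (hα : α ∈ patterns) (c : ℤ)
    (σ τ : List ℤ) (h : word π.2 = σ ++ (word α).map (· + c) ++ τ) :
    ∃ ρ : Perms, word ρ.2 = σ ++ [1 + c, 2 + c, 3 + c] ++ τ ∧
      EqvGen (Rewrites system) π ρ := by
  rcases hα with rfl | rfl | rfl
  · exact ⟨π, by simpa [word_p123] using h, .refl π⟩
  · have hs : Step (word π.2) (σ ++ [1 + c, 2 + c, 3 + c] ++ τ) := by
      rw [h, List.append_assoc, List.append_assoc, word_p132]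
      exact .append_left σ (.r132 _ (by ring) (by ring))
    obtain ⟨ρ, -, hρ⟩ := exists_perms_of_perm hs.perm
    exact ⟨ρ, hρ, .rel _ _ (rewrites_iff_step.2 (hρ ▸ hs))⟩
  · have hs : Step (word π.2) (σ ++ [1 + c, 2 + c, 3 + c] ++ τ) := by
      rw [h, List.append_assoc, List.append_assoc, word_p321]
      exact .append_left σ (.r321 _ (by ring) (by ring))
    obtain ⟨ρ, -, hρ⟩ := exists_perms_of_perm hs.perm
    exact ⟨ρ, hρ, .rel _ _ (rewrites_iff_step.2 (hρ ▸ hs))⟩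

theorem sum_word {k : ℕ} (α β : Equiv.Perm (Fin k)) : (word α).sum = (word β).sum :=
  (perm_word_word α β).sum_eq

theorem eqvGen_of_replacement {π π' : Perms} (h : Rewrites (allReplacements patterns) π π') :
    EqvGen (Rewrites system) π π' := by
  obtain ⟨_, ⟨α, hα, β, hβ, rfl⟩, σ, α', β', τ, hα', hβ', h, h'⟩ := h
  obtain ⟨c, rfl⟩ := (isOccurrence_iff _ _).1 hα'
  obtain ⟨d, rfl⟩ := (isOccurrence_iff _ _).1 hβ'
  have hs := sum_eq_of_word (by simp [length_word]) h h'
  rw [List.sum_map_add, List.sum_map_add] at hs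
  simp only [List.map_id', List.map_const', length_word, List.sum_replicate,
    sum_word α β] at hs
  obtain rfl : c = d := by simpa using hs
  obtain ⟨ρ, hρ, h₁⟩ := eqvGen_p123 hα c σ τ h
  obtain ⟨ρ', hρ', h₂⟩ := eqvGen_p123 hβ c σ τ h'
  rw [← hρ] at hρ'
  rw [perms_ext hρ'] at h₂
  exact h₁.trans _ _ _ h₂.symm

theorem eqvGen_rewrites_iff (π σ : Perms) :
    EqvGen (Rewrites system) π σ ↔ replacementSetoid patterns π σ := by
  change _ ↔ EqvGen (Rewrites (allReplacements patterns)) π σ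
  constructor
  · intro h
    induction h with
    | rel _ _ h => exact replacement_of_step [] (step_of_rewrites h) rfl rfl
    | refl x => exact .refl x
    | symm _ _ _ ih => exact ih.symm
    | trans _ _ _ _ _ h₁ h₂ => exact h₁.trans _ _ _ h₂
  · intro h
    induction h with
    | rel _ _ h => exact eqvGen_of_replacement h
    | refl x => exact .refl x
    | symm _ _ _ ih => exact ih.symm
    | trans _ _ _ _ _ h₁ h₂ => exact h₁.trans _ _ _ h₂

/-! ### Normal forms and equivalence classes -/

/-- The patterns at the left-hand sides of `system`. -/
abbrev forbidden : Set Perms := {⟨3, p132⟩, ⟨3, p321⟩, ⟨4, p2341⟩}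

/-- No rewriting applies to the word `l`. -/
def Normal (l : List ℤ) : Prop := ∀ l', ¬ Step l l'

theorem mem_avoiders_iff {n : ℕ} (π : Equiv.Perm (Fin n)) :
    π ∈ avoiders forbidden n ↔ Normal (word π) := by
  constructor
  · intro h l' hs
    obtain ⟨r, hr, σ, α, β, τ, hα, -, hw, -⟩ := hs.exists_factor
    have hf : (⟨r.1, r.2.1⟩ : Perms) ∈ forbidden := by
      rcases hr with rfl | rfl | rfl <;> simp
    exact h _ hf ⟨α, ⟨σ, τ, hw.symm⟩, hα⟩
  · rintro h p hp ⟨α, ⟨σ, τ, hw⟩, hα⟩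
    rw [List.append_assoc] at hw
    simp only [← hw] at h
    rcases hp with rfl | rfl | rfl
    · obtain ⟨c, rfl⟩ := isOccurrence_p132.1 hα
      exact h _ (Step.append_left σ (.r132 _ (by ring) (by ring)))
    · obtain ⟨c, rfl⟩ := isOccurrence_p321.1 hα
      exact h _ (Step.append_left σ (.r321 _ (by ring) (by ring)))
    · obtain ⟨c, rfl⟩ := isOccurrence_p2341.1 hα
      exact h _ (Step.append_left σ (.r2341 _ (by ring) (by ring) (by ring)))

theorem eq_of_reflTransGen_of_normal {π σ : Perms} (hπ : Normal (word π.2))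
    (h : ReflTransGen (Rewrites system) π σ) : π = σ := by
  rcases ReflTransGen.cases_head h with h | ⟨ρ, h, -⟩
  · exact h
  · exact (hπ _ (step_of_rewrites h)).elim

theorem join_of_eqvGen {π σ : Perms} (h : EqvGen (Rewrites system) π σ) :
    Join (ReflTransGen (Rewrites system)) π σ := by
  induction h with
  | rel _ _ h => exact ⟨_, .single h, .refl⟩
  | refl x => exact ⟨x, .refl, .refl⟩
  | symm _ _ _ ih => exact let ⟨z, p, q⟩ := ih; ⟨z, q, p⟩
  | trans _ y _ _ _ h₁ h₂ =>
    obtain ⟨z, hz₁, hz₂⟩ := h₁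
    obtain ⟨w, hw₁, hw₂⟩ := h₂
    obtain ⟨v, hv₁, hv₂⟩ := confluent_rewrites y z w hz₂ hw₁
    exact ⟨v, hz₁.trans hv₁, hw₂.trans hv₂⟩

theorem exists_normal (π : Perms) :
    ∃ σ : Perms, EqvGen (Rewrites system) π σ ∧ Normal (word σ.2) := by
  induction π using wellFounded_rewrites.induction with
  | _ π ih =>
    by_cases hπ : Normal (word π.2)
    · exact ⟨π, .refl π, hπ⟩
    · simp only [Normal, not_forall, not_not] at hπ
      obtain ⟨l, hl⟩ := hπ
      obtain ⟨ρ, -, rfl⟩ := exists_perms_of_perm hl.perm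
      have hρ := rewrites_iff_step.2 hl
      obtain ⟨σ, hσ, hn⟩ := ih ρ hρ
      exact ⟨σ, (EqvGen.rel _ _ hρ).trans _ _ _ hσ, hn⟩

/-- Termination puts a normal form in every class; confluence makes it unique. -/
theorem card_classes (n : ℕ) :
    Nat.card (Classes (replacementSetoid patterns) n) = Nat.card (avoiders forbidden n) := by
  symm
  refine Nat.card_eq_of_bijective (fun π : avoiders forbidden n =>
    (Quotient.mk _ π.1 : Classes (replacementSetoid patterns) n)) ⟨?_, ?_⟩
  · intro π σ h
    have h' : EqvGen (Rewrites system) ⟨n, π.1⟩ ⟨n, σ.1⟩ :=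
      (eqvGen_rewrites_iff _ _).2 (Quotient.exact
        (s := (replacementSetoid patterns).comap fun π : Equiv.Perm (Fin n) => ⟨n, π⟩) h)
    obtain ⟨z, hz₁, hz₂⟩ := join_of_eqvGen h'
    have h₁ := eq_of_reflTransGen_of_normal ((mem_avoiders_iff _).1 π.2) hz₁
    have h₂ := eq_of_reflTransGen_of_normal ((mem_avoiders_iff _).1 σ.2) hz₂
    exact Subtype.ext (eq_of_heq (Sigma.mk.inj (h₁.trans h₂.symm)).2)
  · intro c
    induction c using Quotient.inductionOn with
    | _ π =>
      obtain ⟨⟨m, σ⟩, hσ, hn⟩ := exists_normal ⟨n, π⟩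
      obtain rfl : n = m := fst_eq_of_eqvGen hσ
      exact ⟨⟨σ, (mem_avoiders_iff _).2 hn⟩, Quotient.sound ((eqvGen_rewrites_iff _ _).1 hσ.symm)⟩

theorem Normal.of_cons {x : ℤ} {l : List ℤ} (h : Normal (x :: l)) : Normal l :=
  fun _ hs => h _ (hs.cons x)

theorem normal_of_length_le_two {l : List ℤ} (h : l.length ≤ 2) : Normal l := by
  rintro l' hs
  induction hs with
  | r132 | r321 | r2341 => simp at h
  | cons x _ ih => exact ih (by simp at h; omega)

/-! ### Inflating and contracting one letter -/

/-- The letters above `v` are moved up by `2`. -/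
def shiftUp (v x : ℤ) : ℤ := if v < x then x + 2 else x

/-- The letters above `v` are moved down by `2`. -/
def shiftDown (v x : ℤ) : ℤ := if v < x then x - 2 else x

/-- The letter `x` is none of `v`, `v + 1`, `v + 2`. -/
def Outside (v x : ℤ) : Prop := x < v ∨ v + 2 < x

theorem shiftUp_injective (v : ℤ) : Function.Injective (shiftUp v) := by
  intro x y h
  unfold shiftUp at h
  split_ifs at h <;> omega

theorem outside_shiftUp {v x : ℤ} (h : x ≠ v) : Outside v (shiftUp v x) := by
  unfold Outside shiftUp
  split_ifs <;> omega

theorem shiftDown_ne {v x : ℤ} (h : Outside v x) : shiftDown v x ≠ v := by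
  unfold Outside at h
  unfold shiftDown
  split_ifs <;> omega

theorem shiftDown_shiftUp (v x : ℤ) : shiftDown v (shiftUp v x) = x := by
  unfold shiftDown shiftUp
  split_ifs <;> omega

theorem shiftUp_shiftDown {v x : ℤ} (h : Outside v x) : shiftUp v (shiftDown v x) = x := by
  unfold Outside at h
  unfold shiftDown shiftUp
  split_ifs <;> omega

theorem map_shiftDown_map_shiftUp (v : ℤ) (l : List ℤ) :
    (l.map (shiftUp v)).map (shiftDown v) = l := by
  simp [Function.comp_def, shiftDown_shiftUp]

theorem map_shiftUp_map_shiftDown {v : ℤ} {l : List ℤ} (h : ∀ x ∈ l, Outside v x) :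
    (l.map (shiftDown v)).map (shiftUp v) = l := by
  rw [List.map_map]
  conv_rhs => rw [← List.map_id l]
  exact List.map_congr_left fun x hx => shiftUp_shiftDown (h x hx)

/-- The values of a left-hand side form an interval. It misses `v`, so it lies on one side of `v`
and is shifted rigidly. -/
theorem Step.map_shiftUp {v : ℤ} {l l' : List ℤ} (h : Step l l') (hv : ∀ x ∈ l, x ≠ v) :
    Step (l.map (shiftUp v)) (l'.map (shiftUp v)) := by
  induction h with
  | r132 τ hb hc =>
    simp only [List.mem_cons, forall_eq_or_imp] at hv
    refine .r132 _ ?_ ?_ <;> unfold shiftUp <;> split_ifs <;> omega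
  | r321 τ hb hc =>
    simp only [List.mem_cons, forall_eq_or_imp] at hv
    refine .r321 _ ?_ ?_ <;> unfold shiftUp <;> split_ifs <;> omega
  | r2341 τ hb hc hd =>
    simp only [List.mem_cons, forall_eq_or_imp] at hv
    refine .r2341 _ ?_ ?_ ?_ <;> unfold shiftUp <;> split_ifs <;> omega
  | cons x _ ih => exact (ih fun y hy => hv y (by simp [hy])).cons _

theorem Step.map_shiftDown {v : ℤ} {l l' : List ℤ} (h : Step l l')
    (hv : ∀ x ∈ l, Outside v x) : Step (l.map (shiftDown v)) (l'.map (shiftDown v)) := by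
  unfold Outside at hv
  induction h with
  | r132 τ hb hc =>
    simp only [List.mem_cons, forall_eq_or_imp] at hv
    refine .r132 _ ?_ ?_ <;> unfold shiftDown <;> split_ifs <;> omega
  | r321 τ hb hc =>
    simp only [List.mem_cons, forall_eq_or_imp] at hv
    refine .r321 _ ?_ ?_ <;> unfold shiftDown <;> split_ifs <;> omega
  | r2341 τ hb hc hd =>
    simp only [List.mem_cons, forall_eq_or_imp] at hv
    refine .r2341 _ ?_ ?_ ?_ <;> unfold shiftDown <;> split_ifs <;> omega
  | cons x _ ih => exact (ih fun y hy => hv y (by simp [hy])).cons _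

theorem Normal.map_shiftUp {v : ℤ} {l : List ℤ} (h : Normal l) (hv : ∀ x ∈ l, x ≠ v) :
    Normal (l.map (shiftUp v)) := by
  intro l' hs
  have := hs.map_shiftDown (v := v) (by
    intro x hx
    obtain ⟨y, hy, rfl⟩ := List.mem_map.1 hx
    exact outside_shiftUp (hv y hy))
  rw [map_shiftDown_map_shiftUp] at this
  exact h _ this

theorem Normal.map_shiftDown {v : ℤ} {l : List ℤ} (h : Normal l) (hv : ∀ x ∈ l, Outside v x) :
    Normal (l.map (shiftDown v)) := by
  intro l' hs
  have := hs.map_shiftUp (v := v) (by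
    intro x hx
    obtain ⟨y, hy, rfl⟩ := List.mem_map.1 hx
    exact shiftDown_ne (hv y hy))
  rw [map_shiftUp_map_shiftDown hv] at this
  exact h _ this

theorem IsWord.expand {n : ℕ} {v : ℤ} {u s t : List ℤ} (h : IsWord n (u ++ v :: s))
    (ht : t.Perm [v, v + 1, v + 2]) :
    IsWord (n + 2) (u.map (shiftUp v) ++ (t ++ s.map (shiftUp v))) := by
  have h' : IsWord n (v :: (u ++ s)) := h.of_perm List.perm_middle.symm
  have key : IsWord (n + 2) ([v, v + 1, v + 2] ++ (u ++ s).map (shiftUp v)) := by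
    obtain ⟨h₁, h₂, h₃⟩ := h'
    rw [List.nodup_cons] at h₁
    simp only [List.mem_cons, forall_eq_or_imp] at h₃
    have ho : ∀ x ∈ (u ++ s).map (shiftUp v), Outside v x := by
      intro x hx
      obtain ⟨y, hy, rfl⟩ := List.mem_map.1 hx
      exact outside_shiftUp fun e => h₁.1 (e ▸ hy)
    unfold Outside at ho
    refine ⟨List.nodup_append.2 ⟨by simp, h₁.2.map (shiftUp_injective v), ?_⟩, ?_, ?_⟩
    · intro a ha b hb
      have := ho b hb
      simp only [List.mem_cons, List.not_mem_nil, or_false] at ha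
      omega
    · simp only [List.length_cons, List.length_append, List.length_map, List.length_nil] at h₂ ⊢
      omega
    · intro x hx
      rcases List.mem_append.1 hx with hx | hx
      · simp only [List.mem_cons, List.not_mem_nil, or_false] at hx
        push_cast
        omega
      · obtain ⟨y, hy, rfl⟩ := List.mem_map.1 hx
        have := h₃.2 y hy
        unfold shiftUp
        push_cast
        split_ifs <;> omega
  refine key.of_perm ?_
  rw [List.map_append]
  refine ((ht.append_right _).append_left _).trans ?_
  rw [← List.append_assoc, ← List.append_assoc]
  exact List.perm_append_comm.append_right _

theorem IsWord.contract {n : ℕ} {v : ℤ} {u s t : List ℤ} (h : IsWord (n + 2) (u ++ (t ++ s)))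
    (ht : t.Perm [v, v + 1, v + 2]) :
    (∀ x ∈ u, Outside v x) ∧ (∀ x ∈ s, Outside v x) ∧
      IsWord n (u.map (shiftDown v) ++ v :: s.map (shiftDown v)) := by
  have h' : IsWord (n + 2) ([v, v + 1, v + 2] ++ (u ++ s)) := by
    refine h.of_perm ?_
    refine (ht.symm.append_right _).trans ?_
    rw [← List.append_assoc, ← List.append_assoc]
    exact List.perm_append_comm.append_right _
  obtain ⟨h₁, h₂, h₃⟩ := h'
  obtain ⟨-, hn, hd⟩ := List.nodup_append.1 h₁
  have hv := h₃ v (by simp)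
  have hv2 := h₃ (v + 2) (by simp)
  push_cast at hv2
  have ho : ∀ x ∈ u ++ s, Outside v x := by
    intro x hx
    have h0 := hd v (by simp) x hx
    have h1 := hd (v + 1) (by simp) x hx
    have h2 := hd (v + 2) (by simp) x hx
    unfold Outside
    omega
  refine ⟨fun x hx => ho x (by simp [hx]), fun x hx => ho x (by simp [hx]), ?_⟩
  refine IsWord.of_perm (l := v :: (u ++ s).map (shiftDown v)) ?_
    (by rw [List.map_append]; exact List.perm_middle)
  refine ⟨List.nodup_cons.2 ⟨?_, ?_⟩, ?_, ?_⟩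
  · rw [List.mem_map]
    rintro ⟨x, hx, hxv⟩
    exact shiftDown_ne (ho x hx) hxv
  · refine hn.map_on fun x hx y hy hxy => ?_
    rw [← shiftUp_shiftDown (ho x hx), hxy, shiftUp_shiftDown (ho y hy)]
  · simp only [List.length_cons, List.length_append, List.length_map, List.length_nil] at h₂ ⊢
    omega
  · intro x hx
    rcases List.mem_cons.1 hx with rfl | hx
    · omega
    · obtain ⟨y, hy, rfl⟩ := List.mem_map.1 hx
      have h4 := h₃ y (by simp only [List.mem_append] at hy ⊢; tauto)
      have h5 := ho y hy
      unfold Outside at h5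
      unfold shiftDown
      push_cast at h4
      split_ifs <;> omega

/-! ### The recurrence for suffix-normal permutations -/

/-- The permutations of length `n`, as words, on which no rewriting applies after the first `p`
letters. -/
def normalFrom (n p : ℕ) : Set (List ℤ) := {l | IsWord n l ∧ Normal (l.drop p)}

/-- Inflate the letter at position `p` to an occurrence of `132`. -/
def inflate132 (p : ℕ) (l : List ℤ) : List ℤ :=
  match l.drop p with
  | [] => []
  | v :: s => (l.take p).map (shiftUp v) ++ ([v, v + 2, v + 1] ++ s.map (shiftUp v))

/-- Inflate the letter at position `p` to an occurrence of `321`, or, if the next letter is smaller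
by one, to an occurrence of `123`, so that `2341` arises. -/
def inflate321 (p : ℕ) (l : List ℤ) : List ℤ :=
  match l.drop p with
  | [] => []
  | v :: s => (l.take p).map (shiftUp v) ++
      ((if s.head? = some (v - 1) then [v, v + 1, v + 2] else [v + 2, v + 1, v]) ++
        s.map (shiftUp v))

theorem inflate132_append (u s : List ℤ) (v : ℤ) : inflate132 u.length (u ++ v :: s) =
    u.map (shiftUp v) ++ ([v, v + 2, v + 1] ++ s.map (shiftUp v)) := by
  simp [inflate132]

theorem inflate321_append (u s : List ℤ) (v : ℤ) : inflate321 u.length (u ++ v :: s) =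
    u.map (shiftUp v) ++
      ((if s.head? = some (v - 1) then [v, v + 1, v + 2] else [v + 2, v + 1, v]) ++
        s.map (shiftUp v)) := by
  simp [inflate321]

theorem exists_split {l : List ℤ} {p : ℕ} (h : p < l.length) :
    ∃ (u : List ℤ) (v : ℤ) (s : List ℤ), l = u ++ v :: s ∧ u.length = p :=
  ⟨l.take p, l[p], l.drop (p + 1), by simp, by simp; omega⟩

theorem exists_split_of_mem {n p : ℕ} (hp : p < n) {l : List ℤ} (h : l ∈ normalFrom n (p + 1)) :
    ∃ (u : List ℤ) (v : ℤ) (s : List ℤ), l = u ++ v :: s ∧ u.length = p ∧ Normal s := by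
  obtain ⟨u, v, s, rfl, rfl⟩ := exists_split (h.1.2.1 ▸ hp)
  exact ⟨u, v, s, rfl, rfl, by simpa using h.2⟩

theorem inflate132_injOn {n p : ℕ} (hp : p < n) :
    Set.InjOn (inflate132 p) (normalFrom n (p + 1)) := by
  intro l hl l' hl' h
  obtain ⟨u, v, s, rfl, hu, -⟩ := exists_split_of_mem hp hl
  obtain ⟨u', v', s', rfl, rfl, -⟩ := exists_split_of_mem hp hl'
  rw [inflate132_append, ← hu, inflate132_append] at h
  obtain ⟨h₁, h₂⟩ := List.append_inj h (by simpa using hu)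
  simp only [List.cons_append, List.nil_append, List.cons.injEq] at h₂
  obtain ⟨rfl, -, -, h₂⟩ := h₂
  rw [(List.map_injective_iff.2 (shiftUp_injective v)) h₁,
    (List.map_injective_iff.2 (shiftUp_injective v)) h₂]

theorem inflate321_injOn {n p : ℕ} (hp : p < n) :
    Set.InjOn (inflate321 p) (normalFrom n (p + 1)) := by
  intro l hl l' hl' h
  obtain ⟨u, v, s, rfl, hu, -⟩ := exists_split_of_mem hp hl
  obtain ⟨u', v', s', rfl, rfl, -⟩ := exists_split_of_mem hp hl'
  rw [inflate321_append, ← hu, inflate321_append] at h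
  obtain ⟨h₁, h₂⟩ := List.append_inj h (by simpa using hu)
  obtain ⟨h₃, h₂⟩ := List.append_inj h₂ (by split_ifs <;> rfl)
  -- An increasing block is never a decreasing one, so the branches agree and the block reveals the
  -- inflated letter.
  obtain rfl : v = v' := by
    split_ifs at h₃ <;> simp only [List.cons.injEq] at h₃ <;> omega
  rw [(List.map_injective_iff.2 (shiftUp_injective v)) h₁,
    (List.map_injective_iff.2 (shiftUp_injective v)) h₂]

theorem outside_map_shiftUp {n : ℕ} {v : ℤ} {u s : List ℤ} (h : IsWord n (u ++ v :: s)) :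
    (∀ x ∈ s, x ≠ v) ∧ ∀ x ∈ s.map (shiftUp v), x < v ∨ v + 2 < x := by
  have h₁ : ∀ x ∈ s, x ≠ v := by
    have := (List.nodup_cons.1 (List.nodup_append.1 h.1).2.1).1
    rintro x hx rfl
    exact this hx
  refine ⟨h₁, fun x hx => ?_⟩
  obtain ⟨y, hy, rfl⟩ := List.mem_map.1 hx
  exact outside_shiftUp (h₁ y hy)

theorem drop_length_map_append (u : List ℤ) (f : ℤ → ℤ) (t : List ℤ) :
    (u.map f ++ t).drop u.length = t := by
  rw [← List.length_map (f := f) (as := u), List.drop_left]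

theorem drop_length_succ_map_append (u : List ℤ) (f : ℤ → ℤ) (x : ℤ) (t : List ℤ) :
    (u.map f ++ x :: t).drop (u.length + 1) = t := by
  rw [← List.drop_drop, drop_length_map_append, List.drop_one, List.tail_cons]

theorem inflate132_mem {n : ℕ} {u s : List ℤ} {v : ℤ} (h : IsWord n (u ++ v :: s))
    (hs : Normal s) :
    inflate132 u.length (u ++ v :: s) ∈ normalFrom (n + 2) (u.length + 1) := by
  obtain ⟨h₁, ho⟩ := outside_map_shiftUp h
  have hn := hs.map_shiftUp h₁
  rw [inflate132_append]
  refine ⟨h.expand ((List.Perm.swap _ _ _).cons _), ?_⟩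
  have : (u.map (shiftUp v) ++ ([v, v + 2, v + 1] ++ s.map (shiftUp v))).drop (u.length + 1) =
      (v + 2) :: (v + 1) :: s.map (shiftUp v) :=
    drop_length_succ_map_append _ _ _ _
  rw [this]
  generalize s.map (shiftUp v) = t at ho hn
  rintro l' (_ | _ | _ | ⟨_, _ | _ | _ | ⟨_, h⟩⟩)
  on_goal 7 => exact hn _ h
  all_goals simp only [List.mem_cons, forall_eq_or_imp] at ho
  all_goals omega

/-- A decreasing block followed by `v - 1` would leave a 321 starting at position p + 1. Using an
increasing block there avoids this. -/
theorem inflate321_mem {n : ℕ} {u s : List ℤ} {v : ℤ} (h : IsWord n (u ++ v :: s))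
    (hs : Normal s) :
    inflate321 u.length (u ++ v :: s) ∈ normalFrom (n + 2) (u.length + 1) := by
  obtain ⟨h₁, ho⟩ := outside_map_shiftUp h
  have hn := hs.map_shiftUp h₁
  rw [inflate321_append]
  have hd (a b c : ℤ) : (u.map (shiftUp v) ++ ([a, b, c] ++ s.map (shiftUp v))).drop
      (u.length + 1) = b :: c :: s.map (shiftUp v) :=
    drop_length_succ_map_append _ _ _ _
  split_ifs with hh
  · refine ⟨h.expand (List.Perm.refl _), ?_⟩
    rw [hd]
    obtain ⟨s', rfl⟩ : ∃ s', s = (v - 1) :: s' := by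
      cases s with
      | nil => simp at hh
      | cons x s' => exact ⟨s', by simpa using hh⟩
    have hv : shiftUp v (v - 1) = v - 1 := by unfold shiftUp; split_ifs <;> omega
    rw [List.map_cons, hv] at hn ho ⊢
    generalize s'.map (shiftUp v) = t at ho hn
    rintro l' (_ | _ | _ | ⟨_, _ | _ | _ | ⟨_, h⟩⟩)
    on_goal 7 => exact hn _ h
    all_goals simp only [List.mem_cons, forall_eq_or_imp] at ho
    all_goals omega
  · refine ⟨h.expand ?_, ?_⟩
    · rw [List.perm_iff_count]; intro x; simp only [List.count_cons]; omega
    rw [hd]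
    have hh' : ∀ x ∈ (s.map (shiftUp v)).head?, x ≠ v - 1 := by
      cases s with
      | nil => simp
      | cons y s' =>
        have : y ≠ v - 1 := by simpa using hh
        have h2 := h₁ y (by simp)
        simp only [List.map_cons, List.head?_cons, Option.mem_some_iff, forall_eq']
        unfold shiftUp
        split_ifs <;> omega
    generalize s.map (shiftUp v) = t at ho hn hh'
    rintro l' (_ | _ | _ | ⟨_, _ | _ | _ | ⟨_, h⟩⟩)
    on_goal 7 => exact hn _ h
    all_goals simp only [List.mem_cons, forall_eq_or_imp] at ho
    all_goals simp only [List.head?_cons, Option.mem_some_iff, forall_eq'] at hh'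
    all_goals omega

theorem normalFrom_succ {n p : ℕ} (hp : p < n) :
    normalFrom (n + 2) (p + 1) = normalFrom (n + 2) p ∪
      (inflate132 p '' normalFrom n (p + 1) ∪ inflate321 p '' normalFrom n (p + 1)) := by
  ext l
  constructor
  · intro hl
    obtain ⟨u, v, s, rfl, rfl, hs⟩ := exists_split_of_mem (by omega) hl
    have hw := hl.1
    by_cases hn : Normal (v :: s)
    · exact .inl ⟨hl.1, by simpa using hn⟩
    right
    simp only [Normal, not_forall, not_not] at hn
    -- As `s` is normal, this step must act on a factor beginning with `v`.
    obtain ⟨t, ht⟩ := hn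
    have key (a : ℤ) (b s : List ℤ) (hb : b.Perm [a, a + 1, a + 2])
        (hw : IsWord (n + 2) (u ++ (b ++ s))) (hs : Normal s) :
        u.map (shiftDown a) ++ a :: s.map (shiftDown a) ∈ normalFrom n (u.length + 1) ∧
        (∀ x ∈ s, Outside a x) ∧
        (u.map (shiftDown a)).map (shiftUp a) ++
          (b ++ (s.map (shiftDown a)).map (shiftUp a)) = u ++ (b ++ s) := by
      obtain ⟨hu, ho, h⟩ := hw.contract hb
      refine ⟨⟨h, ?_⟩, ho, ?_⟩
      · rw [drop_length_succ_map_append]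
        exact hs.map_shiftDown ho
      · rw [map_shiftUp_map_shiftDown hu, map_shiftUp_map_shiftDown ho]
    cases ht with
    | @r132 _ b c τ hb hc =>
      subst hb hc
      obtain ⟨h₁, -, h₂⟩ := key v [v, v + 2, v + 1] τ ((List.Perm.swap _ _ _).cons _) hw
        hs.of_cons.of_cons
      refine .inl ⟨_, h₁, ?_⟩
      have := inflate132_append (u.map (shiftDown v)) (τ.map (shiftDown v)) v
      rw [List.length_map] at this
      rw [this, h₂]
      rfl
    | @r321 _ b c τ hb hc =>
      obtain ⟨a, rfl⟩ : ∃ a, v = a + 2 := ⟨v - 2, by ring⟩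
      obtain rfl : b = a + 1 := by omega
      obtain rfl : c = a := by omega
      obtain ⟨h₁, ho, h₂⟩ := key c [c + 2, c + 1, c] τ (by
        rw [List.perm_iff_count]; intro x; simp only [List.count_cons]; omega) hw
        hs.of_cons.of_cons
      refine .inr ⟨_, h₁, ?_⟩
      have := inflate321_append (u.map (shiftDown c)) (τ.map (shiftDown c)) c
      rw [List.length_map] at this
      rw [this, if_neg, h₂]
      · rfl
      · cases τ with
        | nil => simp
        | cons x τ =>
          have hx := ho x (by simp)
          -- Otherwise c + 1, c, c − 1 would be a 321 inside the normal tail.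
          have hx' : x ≠ c - 1 := by
            rintro rfl
            exact hs _ (.r321 _ (by ring) (by ring))
          unfold Outside at hx
          simp only [List.map_cons, List.head?_cons, Option.some.injEq]
          unfold shiftDown
          split_ifs <;> omega
    | @r2341 _ b c d τ hb hc hd =>
      subst hb hc hd
      -- Only the 234 is contracted; the remaining letter `v - 1` selects the increasing branch of
      -- `inflate321`.
      obtain ⟨h₁, -, h₂⟩ := key v [v, v + 1, v + 2] ((v - 1) :: τ) (.refl _) hw
        hs.of_cons.of_cons
      refine .inr ⟨_, h₁, ?_⟩
      have := inflate321_append (u.map (shiftDown v)) (((v - 1) :: τ).map (shiftDown v)) v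
      rw [List.length_map] at this
      rw [this, if_pos, h₂]
      · rfl
      · simp [shiftDown]
    | cons _ h => exact (hs _ h).elim
  · rintro (hl | ⟨l, hl, rfl⟩ | ⟨l, hl, rfl⟩)
    · refine ⟨hl.1, ?_⟩
      obtain ⟨u, v, s, rfl, rfl⟩ := exists_split (p := p) (l := l) (by rw [hl.1.2.1]; omega)
      have := hl.2
      rw [List.drop_left] at this
      simpa using this.of_cons
    · obtain ⟨u, v, s, rfl, rfl, hs⟩ := exists_split_of_mem hp hl
      exact inflate132_mem hl.1 hs
    · obtain ⟨u, v, s, rfl, rfl, hs⟩ := exists_split_of_mem hp hl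
      exact inflate321_mem hl.1 hs

theorem disjoint_inflate {n p : ℕ} (hp : p < n) :
    Disjoint (inflate132 p '' normalFrom n (p + 1)) (inflate321 p '' normalFrom n (p + 1)) := by
  rw [Set.disjoint_left]
  rintro _ ⟨l, hl, rfl⟩ ⟨l', hl', h⟩
  obtain ⟨u, v, s, rfl, hu, -⟩ := exists_split_of_mem hp hl
  obtain ⟨u', v', s', rfl, rfl, -⟩ := exists_split_of_mem hp hl'
  rw [inflate321_append, ← hu, inflate132_append] at h
  obtain ⟨-, h⟩ := List.append_inj h (by simpa using hu.symm)
  split_ifs at h <;> simp only [List.cons_append, List.cons.injEq] at h <;> omega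

/-- Inflation creates a left-hand side starting exactly at position p. -/
theorem disjoint_normalFrom {n p : ℕ} (hp : p < n) :
    Disjoint (normalFrom (n + 2) p)
      (inflate132 p '' normalFrom n (p + 1) ∪ inflate321 p '' normalFrom n (p + 1)) := by
  rw [Set.disjoint_left]
  rintro _ hl (⟨l, hl', rfl⟩ | ⟨l, hl', rfl⟩)
  · obtain ⟨u, v, s, rfl, rfl, -⟩ := exists_split_of_mem hp hl'
    have := hl.2
    rw [inflate132_append, drop_length_map_append] at this
    exact this _ (.r132 _ rfl rfl)
  · obtain ⟨u, v, s, rfl, rfl, -⟩ := exists_split_of_mem hp hl'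
    have := hl.2
    rw [inflate321_append, drop_length_map_append] at this
    split_ifs at this with hh
    · cases s with
      | nil => simp at hh
      | cons x s =>
        obtain rfl : x = v - 1 := by simpa using hh
        exact this _ (.r2341 _ rfl rfl (by simp [shiftUp]))
    · exact this _ (.r321 _ (by ring) (by ring))

theorem setOf_isWord (n : ℕ) : {l | IsWord n l} = Set.range (word (n := n)) := by
  ext l
  exact ⟨IsWord.exists_word, by rintro ⟨π, rfl⟩; exact isWord_word π⟩

theorem finite_normalFrom (n p : ℕ) : (normalFrom n p).Finite :=
  ((setOf_isWord n ▸ Set.finite_range _ : {l | IsWord n l}.Finite)).subset fun _ h => h.1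

theorem ncard_normalFrom_succ {n p : ℕ} (hp : p < n) :
    (normalFrom (n + 2) (p + 1)).ncard =
      (normalFrom (n + 2) p).ncard + 2 * (normalFrom n (p + 1)).ncard := by
  have hf := finite_normalFrom n (p + 1)
  rw [normalFrom_succ hp, Set.ncard_union_eq (disjoint_normalFrom hp) (finite_normalFrom _ _)
    ((hf.image _).union (hf.image _)), Set.ncard_union_eq (disjoint_inflate hp) (hf.image _)
    (hf.image _), (inflate132_injOn hp).ncard_image,
    (inflate321_injOn hp).ncard_image]
  ring

theorem normalFrom_eq_of_le {n p : ℕ} (h : n ≤ p + 2) : normalFrom n p = {l | IsWord n l} := by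
  ext l
  refine ⟨fun h => h.1, fun hl => ⟨hl, normal_of_length_le_two ?_⟩⟩
  rw [List.length_drop, hl.2.1]
  omega

theorem ncard_normalFrom_self (p : ℕ) : (normalFrom p p).ncard = p.factorial := by
  rw [normalFrom_eq_of_le (by omega), setOf_isWord, ← Set.image_univ,
    Set.ncard_image_of_injective _ word_injective, Set.ncard_univ, Nat.card_eq_fintype_card,
    Fintype.card_perm, Fintype.card_fin]

theorem card_avoiders (n : ℕ) :
    Nat.card (avoiders forbidden n) = (normalFrom n 0).ncard := by
  have : normalFrom n 0 = word '' avoiders forbidden n := by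
    ext l
    constructor
    · rintro ⟨h, hn⟩
      obtain ⟨π, rfl⟩ := h.exists_word
      exact ⟨π, (mem_avoiders_iff π).2 hn, rfl⟩
    · rintro ⟨π, hπ, rfl⟩
      exact ⟨isWord_word π, (mem_avoiders_iff π).1 hπ⟩
  rw [this, Nat.card_coe_set_eq, Set.ncard_image_of_injective _ word_injective]

/-! ### The generating function -/

open PowerSeries in
/-- The generating function of `normalFrom (p + s) p`, by the length `s` of the suffix. -/
noncomputable def suffixSeries (p : ℕ) : PowerSeries ℤ :=
  mk fun s => ((normalFrom (p + s) p).ncard : ℤ)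

open PowerSeries in
theorem suffixSeries_eq (p : ℕ) :
    suffixSeries p = (p.factorial : PowerSeries ℤ) + X * (1 - 2 * X ^ 2) *
      suffixSeries (p + 1) := by
  have h0 : (X * (1 - 2 * X ^ 2) * suffixSeries (p + 1) : PowerSeries ℤ) =
      X * suffixSeries (p + 1) - C 2 * (X ^ 3 * suffixSeries (p + 1)) := by
    rw [show (C 2 : PowerSeries ℤ) = 2 from rfl]
    ring
  rw [h0, show (p.factorial : PowerSeries ℤ) = C (p.factorial : ℤ) by simp]
  ext s
  -- Suffixes of at most two letters contain no left-hand side; the x³ term does not yet contribute.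
  have hlow (s : ℕ) (hs : s + 1 ≤ 2) :
      normalFrom (p + (s + 1)) p = normalFrom (p + 1 + s) (p + 1) := by
    rw [normalFrom_eq_of_le (by omega), normalFrom_eq_of_le (by omega), add_assoc, add_comm 1 s]
  rw [map_add, map_sub, coeff_C_mul, coeff_X_pow_mul', coeff_C]
  match s with
  | 0 => simp [suffixSeries, ncard_normalFrom_self]
  | 1 => simp [suffixSeries, coeff_succ_X_mul, hlow 0]
  | 2 => simp [suffixSeries, coeff_succ_X_mul, hlow 1]
  | s + 3 =>
    rw [coeff_succ_X_mul]
    have := ncard_normalFrom_succ (n := p + 1 + s) (p := p) (by omega)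
    have e1 : p + (s + 3) = p + 1 + s + 2 := by omega
    have e2 : p + 1 + (s + 2) = p + 1 + s + 2 := by omega
    simp [suffixSeries, e1, e2, this]

open PowerSeries in
theorem suffixSeries_zero_eq (M : ℕ) :
    suffixSeries 0 = (∑ m ∈ Finset.range M,
      (m.factorial : PowerSeries ℤ) * (X * (1 - 2 * X ^ 2)) ^ m) +
      (X * (1 - 2 * X ^ 2)) ^ M * suffixSeries M := by
  induction M with
  | zero => simp
  | succ M ih =>
    rw [ih, suffixSeries_eq M, Finset.sum_range_succ]
    ring

open PowerSeries in
-- This removes the remainder of the iterated equation, and the terms m > d, from the coefficient of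
-- xᵈ.
theorem coeff_mul_pow_eq_zero {d M : ℕ} (h : d < M) (f g : PowerSeries ℤ) :
    coeff d ((X * f) ^ M * g) = 0 := by
  rw [mul_pow, mul_assoc, coeff_X_pow_mul', if_neg (by omega)]

open PowerSeries in
theorem hasSum_avoiders :
    HasSum (fun m : ℕ => (m.factorial : PowerSeries ℤ) * (X * (1 - 2 * X ^ 2)) ^ m)
      (mk fun n : ℕ => (Nat.card (avoiders forbidden n) : ℤ)) := by
  have h0 : (mk fun n : ℕ => (Nat.card (avoiders forbidden n) : ℤ)) = suffixSeries 0 := by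
    ext n
    rw [suffixSeries, coeff_mk, coeff_mk, card_avoiders, zero_add]
  rw [h0, WithPiTopology.hasSum_iff_hasSum_coeff]
  intro d
  have hc : coeff d (suffixSeries 0) = ∑ m ∈ Finset.range (d + 1),
      coeff d ((m.factorial : PowerSeries ℤ) * (X * (1 - 2 * X ^ 2)) ^ m) := by
    rw [suffixSeries_zero_eq (d + 1), map_add, map_sum, coeff_mul_pow_eq_zero (by omega), add_zero]
  rw [hc]
  refine hasSum_sum_of_ne_finset_zero fun m hm => ?_
  rw [mul_comm]
  exact coeff_mul_pow_eq_zero (by simpa using hm) _ _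

end Hertzsprung

theorem mainTheorem3 :
    Hertzsprung.Terminating (Hertzsprung.Rewrites Hertzsprung.system) ∧
    Hertzsprung.Confluent (Hertzsprung.Rewrites Hertzsprung.system) ∧
    (∀ π σ : Hertzsprung.Perms,
      Relation.EqvGen (Hertzsprung.Rewrites Hertzsprung.system) π σ ↔
        Hertzsprung.replacementSetoid
          {Hertzsprung.p123, Hertzsprung.p132, Hertzsprung.p321} π σ) ∧
    (∀ n : ℕ,
      Nat.card (Hertzsprung.Classes (Hertzsprung.replacementSetoid
          {Hertzsprung.p123, Hertzsprung.p132, Hertzsprung.p321}) n) =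
        Nat.card (Hertzsprung.avoiders
          {⟨3, Hertzsprung.p132⟩, ⟨3, Hertzsprung.p321⟩, ⟨4, Hertzsprung.p2341⟩} n)) ∧
    HasSum
      (fun m : ℕ => (Nat.factorial m : PowerSeries ℤ) *
        (PowerSeries.X * (1 - 2 * PowerSeries.X ^ 2)) ^ m)
      (PowerSeries.mk fun n : ℕ => (Nat.card (Hertzsprung.avoiders
          {⟨3, Hertzsprung.p132⟩, ⟨3, Hertzsprung.p321⟩, ⟨4, Hertzsprung.p2341⟩} n) : ℤ)) :=
  ⟨Hertzsprung.terminating_of_wellFounded Hertzsprung.wellFounded_rewrites,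
    Hertzsprung.confluent_rewrites, Hertzsprung.eqvGen_rewrites_iff, Hertzsprung.card_classes,
    Hertzsprung.hasSum_avoiders⟩
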